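/- Let $\mathbb{K}$ be an algebraically closed field and let $V$ be a vector space over $\mathbb{K}$ of finite positive dimension. A *tridiagonal pair* on $V$ is an ordered pair $A, A^*\in \mathrm{End}(V)$ such that: (i) $A$ and $A^*$ are diagonalizable; (ii) there is an ordering $V_0,\dots,V_d$ of the eigenspaces of $A$ with $A^*V_i\subseteq V_{i-1}+V_i+V_{i+1}$ for $0\le i\le d$, where $V_{-1}=V_{d+1}=0$; (iii) there is an ordering $V_0^*,\dots,V_\delta^*$ of the eigenspaces of $A^*$ with $AV_i^*\subseteq V_{i-1}^*+V_i^*+V_{i+1}^*$ for $0\le i\le \delta$, where $V^*_{-1}=V^*_{\delta+1}=0$; (iv) no subspace $W$ with $W\ne 0$, $W\neq V$ satisfies $AW\subseteq W$ and $A^*W\subseteq W$. Orderings as in (ii), (iii) are called *standard*. A *tridiagonal system* of diameter $d$ on $V$ is a sequence $\Phi=(A;\{E_i\}_{i=0}^d;A^*;\{E_i^*\}_{i=0}^d)$ where $A,A^*$ is a tridiagonal pair on $V$ and $\{E_i\}_{i=0}^d$ (resp. $\{E_i^*\}_{i=0}^d$) are the primitive idempotents of $A$ (resp. $A^*$), that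 is, the projections onto its eigenspaces, listed in a standard order. Let $\theta_i$ (resp. $\theta_i^*$) be the eigenvalue of $A$ (resp. $A^*$) associated with $E_i$ (resp. $E_i^*$). Let $\Phi$ be a tridiagonal system on $V$ of diameter $d\ge 1$ which has $q$-Racah type: $q,a,b\in\mathbb{K}$ are nonzero, $q^4\neq 1$, and $$\theta_i=aq^{d-2i}+a^{-1}q^{2i-d},\qquad \theta_i^*=bq^{d-2i}+b^{-1}q^{2i-d}\qquad(0\le i\le d).$$ For $0\le i\le d$ put $U_i=(E_0^*V+\cdots+E_i^*V)\cap(E_iV+\cdots+E_dV)$. For $0\le i\le d/2$ put $K_i=(E_0^*V+\cdots+E_i^*V)\cap(E_iV+\cdots+E_{d-i}V)$. For $0\le i\le j\le d+1$ put $\tau_{ij}(x)=(x-\theta_i)(x-\theta_{i+1})\cdots(x-\theta_{j-1})$. Then the following hold. 1. There is a unique $K\in\mathrm{End}(V)$ such that $(K-q^{d-2i}I)U_i=0$ for $0\le i\le d$, and $K$ is invertible. 2. There is a unique $\psi\in\mathrm{End}(V)$ such that for $0\le i\le d/2$ and $v\in K_i$ we have $\psi v=0$ and $$\psi\,\tau_{ij}(A)v=(q^{j-i}-q^{i-j})(q^{d-i-j+1}-q^{i+j-d-1})\,\tau_{i,j-1}(A)v\qquad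 (i<j\le d-i).$$ 3. Let $R=A-aK-a^{-1}K^{-1}$, and let $U_q(\mathfrak{sl}_2)$ be the unital associative $\mathbb{K}$-algebra with generators $e,f,k,k^{-1}$ and relations $$kk^{-1}=k^{-1}k=1,\quad kek^{-1}=q^2e,\quad kfk^{-1}=q^{-2}f,\quad ef-fe=\frac{k-k^{-1}}{q-q^{-1}}.$$ There exists a $U_q(\mathfrak{sl}_2)$-module structure on $V$ (compatible with its $\mathbb{K}$-vector space structure) for which $e$ acts as $(q-q^{-1})^{-1}\psi$, $f$ acts as $(q-q^{-1})^{-1}R$, $k$ acts as $K$, and $k^{-1}$ acts as $K^{-1}$. -/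

import Mathlib

section TridiagonalPairs

variable {𝕜 V : Type*} [Field 𝕜] [AddCommGroup V] [Module 𝕜 V]

/-- `A` is diagonalizable: `V` is spanned by the eigenspaces of `A`. -/
def IsDiagonalizableMap (A : Module.End 𝕜 V) : Prop :=
  ⨆ μ : 𝕜, Module.End.eigenspace A μ = ⊤

/-- `θ 0, …, θ d` lists every eigenvalue of `A` exactly once, and the corresponding ordering
`V i = eigenspace A (θ i)` of the eigenspaces of `A` is standard with respect to `B`:
`B (V i) ⊆ V (i-1) + V i + V (i+1)` for `0 ≤ i ≤ d`, where `V (-1) = V (d+1) = 0`. -/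
structure IsStandardOrdering (A B : Module.End 𝕜 V) {d : ℕ} (θ : Fin (d + 1) → 𝕜) : Prop where
  injective : Function.Injective θ
  hasEigenvalue_iff : ∀ μ : 𝕜, Module.End.HasEigenvalue A μ ↔ ∃ i, θ i = μ
  tridiagonal : ∀ i : Fin (d + 1), ∀ v ∈ Module.End.eigenspace A (θ i),
    B v ∈ ⨆ j : Fin (d + 1), ⨆ _ : (j : ℕ) ≤ (i : ℕ) + 1 ∧ (i : ℕ) ≤ (j : ℕ) + 1,
      Module.End.eigenspace A (θ j)

/-- The ordered pair `A, Astar` is a tridiagonal pair on `V`. (That `V` has finite positive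
dimension is assumed where this is used.) -/
structure IsTDPair (A Astar : Module.End 𝕜 V) : Prop where
  diagonalizable : IsDiagonalizableMap A
  diagonalizable_star : IsDiagonalizableMap Astar
  exists_standard : ∃ (d : ℕ) (θ : Fin (d + 1) → 𝕜), IsStandardOrdering A Astar θ
  exists_standard_star :
    ∃ (δ : ℕ) (θstar : Fin (δ + 1) → 𝕜), IsStandardOrdering Astar A θstar
  irreducible : ∀ W : Submodule 𝕜 V,
    (∀ v ∈ W, A v ∈ W) → (∀ v ∈ W, Astar v ∈ W) → W = ⊥ ∨ W = ⊤

/-- `E i` is the primitive idempotent of `A` associated with the eigenvalue `θ i`: it is the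
identity on the eigenspace of `θ i` and vanishes on the eigenspaces of the other `θ j`. -/
def ArePrimitiveIdempotents (A : Module.End 𝕜 V) {d : ℕ} (θ : Fin (d + 1) → 𝕜)
    (E : Fin (d + 1) → Module.End 𝕜 V) : Prop :=
  ∀ i j : Fin (d + 1), ∀ v ∈ Module.End.eigenspace A (θ j), E i v = if i = j then v else 0

end TridiagonalPairs

/-- A tridiagonal system `(A; {E i}; Astar; {Estar i})` of diameter `d` on `V`. The eigenvalue
sequence `θ` and the dual eigenvalue sequence `θstar`, which are determined by these data, are
recorded along with them. -/
structure TDSystem (𝕜 V : Type*) [Field 𝕜] [AddCommGroup V] [Module 𝕜 V] (d : ℕ) where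
  A : Module.End 𝕜 V
  Astar : Module.End 𝕜 V
  E : Fin (d + 1) → Module.End 𝕜 V
  Estar : Fin (d + 1) → Module.End 𝕜 V
  θ : Fin (d + 1) → 𝕜
  θstar : Fin (d + 1) → 𝕜
  isTDPair : IsTDPair A Astar
  standard : IsStandardOrdering A Astar θ
  standard_star : IsStandardOrdering Astar A θstar
  idempotents : ArePrimitiveIdempotents A θ E
  idempotents_star : ArePrimitiveIdempotents Astar θstar Estar

namespace TDSystem

variable {𝕜 V : Type*} [Field 𝕜] [AddCommGroup V] [Module 𝕜 V] {d : ℕ}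

/-- The tridiagonal system has `q`-Racah type, with parameters `q, a, b`. -/
structure IsQRacah (Φ : TDSystem 𝕜 V d) (q a b : 𝕜) : Prop where
  q_ne_zero : q ≠ 0
  a_ne_zero : a ≠ 0
  b_ne_zero : b ≠ 0
  q_pow_four_ne_one : q ^ 4 ≠ 1
  θ_eq : ∀ i : Fin (d + 1),
    Φ.θ i = a * q ^ ((d : ℤ) - 2 * (i : ℤ)) + a⁻¹ * q ^ (2 * (i : ℤ) - (d : ℤ))
  θstar_eq : ∀ i : Fin (d + 1),
    Φ.θstar i = b * q ^ ((d : ℤ) - 2 * (i : ℤ)) + b⁻¹ * q ^ (2 * (i : ℤ) - (d : ℤ))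

/-- The component `U i = (E*₀V + ⋯ + E*ᵢV) ∩ (EᵢV + ⋯ + E_dV)` of the first split
decomposition. -/
def U (Φ : TDSystem 𝕜 V d) (i : Fin (d + 1)) : Submodule 𝕜 V :=
  (⨆ j : Fin (d + 1), ⨆ _ : j ≤ i, LinearMap.range (Φ.Estar j)) ⊓
    (⨆ j : Fin (d + 1), ⨆ _ : i ≤ j, LinearMap.range (Φ.E j))

/-- The subspace `K i = (E*₀V + ⋯ + E*ᵢV) ∩ (EᵢV + ⋯ + E_{d-i}V)`, used for `0 ≤ i ≤ d/2`. -/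
def lowest (Φ : TDSystem 𝕜 V d) (i : ℕ) : Submodule 𝕜 V :=
  (⨆ j : Fin (d + 1), ⨆ _ : (j : ℕ) ≤ i, LinearMap.range (Φ.Estar j)) ⊓
    (⨆ j : Fin (d + 1), ⨆ _ : i ≤ (j : ℕ) ∧ (j : ℕ) + i ≤ d, LinearMap.range (Φ.E j))

/-- The polynomial `τ i j = (x - θ i)(x - θ (i+1)) ⋯ (x - θ (j-1))`, for `i ≤ j ≤ d + 1`. -/
noncomputable def τ (Φ : TDSystem 𝕜 V d) (i j : ℕ) : Polynomial 𝕜 :=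
  ∏ h ∈ Finset.univ.filter (fun h : Fin (d + 1) => i ≤ (h : ℕ) ∧ (h : ℕ) < j),
    (Polynomial.X - Polynomial.C (Φ.θ h))

/-- The defining property of the map `K`: it acts on `U i` as `q^(d-2i)`, for `0 ≤ i ≤ d`. -/
def IsK (Φ : TDSystem 𝕜 V d) (q : 𝕜) (X : Module.End 𝕜 V) : Prop :=
  ∀ i : Fin (d + 1), ∀ v ∈ Φ.U i, X v = q ^ ((d : ℤ) - 2 * (i : ℤ)) • v

/-- The defining property of the double lowering operator `ψ`: for `0 ≤ i ≤ d/2` and `v ∈ K i`,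
`ψ v = 0`, and
`ψ τᵢⱼ(A) v = (q^(j-i) - q^(i-j)) (q^(d-i-j+1) - q^(i+j-d-1)) τᵢ,ⱼ₋₁(A) v` for `i < j ≤ d - i`. -/
def IsPsi (Φ : TDSystem 𝕜 V d) (q : 𝕜) (X : Module.End 𝕜 V) : Prop :=
  ∀ i : ℕ, 2 * i ≤ d → ∀ v ∈ Φ.lowest i,
    X v = 0 ∧
    ∀ j : ℕ, i < j → i + j ≤ d →
      X (Polynomial.aeval Φ.A (Φ.τ i j) v) =
        ((q ^ ((j : ℤ) - (i : ℤ)) - q ^ ((i : ℤ) - (j : ℤ))) *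
          (q ^ ((d : ℤ) - (i : ℤ) - (j : ℤ) + 1) - q ^ ((i : ℤ) + (j : ℤ) - (d : ℤ) - 1))) •
        Polynomial.aeval Φ.A (Φ.τ i (j - 1)) v

/-- The raising map `R = A - a K - a⁻¹ K⁻¹`. -/
def raising (Φ : TDSystem 𝕜 V d) (a : 𝕜) (K : (Module.End 𝕜 V)ˣ) : Module.End 𝕜 V :=
  Φ.A - a • (K : Module.End 𝕜 V) - a⁻¹ • ((K⁻¹ : (Module.End 𝕜 V)ˣ) : Module.End 𝕜 V)

end TDSystem

/-- The four Chevalley generators `e, f, k, k⁻¹`. -/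
inductive UqGen where
  | e
  | f
  | k
  | kinv

/-- The defining relations of `U_q(sl₂)`, in the free algebra on the Chevalley generators. -/
inductive UqRel (𝕜 : Type*) [Field 𝕜] (q : 𝕜) :
    FreeAlgebra 𝕜 UqGen → FreeAlgebra 𝕜 UqGen → Prop where
  | k_mul_kinv : UqRel 𝕜 q (FreeAlgebra.ι 𝕜 .k * FreeAlgebra.ι 𝕜 .kinv) 1
  | kinv_mul_k : UqRel 𝕜 q (FreeAlgebra.ι 𝕜 .kinv * FreeAlgebra.ι 𝕜 .k) 1
  | k_e_kinv : UqRel 𝕜 q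
      (FreeAlgebra.ι 𝕜 .k * FreeAlgebra.ι 𝕜 .e * FreeAlgebra.ι 𝕜 .kinv)
      (q ^ 2 • FreeAlgebra.ι 𝕜 .e)
  | k_f_kinv : UqRel 𝕜 q
      (FreeAlgebra.ι 𝕜 .k * FreeAlgebra.ι 𝕜 .f * FreeAlgebra.ι 𝕜 .kinv)
      ((q ^ 2)⁻¹ • FreeAlgebra.ι 𝕜 .f)
  | e_f_comm : UqRel 𝕜 q
      (FreeAlgebra.ι 𝕜 .e * FreeAlgebra.ι 𝕜 .f - FreeAlgebra.ι 𝕜 .f * FreeAlgebra.ι 𝕜 .e)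
      ((q - q⁻¹)⁻¹ • (FreeAlgebra.ι 𝕜 .k - FreeAlgebra.ι 𝕜 .kinv))

/-- The quantum algebra `U_q(sl₂)`: the unital associative `𝕜`-algebra presented by the Chevalley
generators and the above relations. -/
abbrev Uq (𝕜 : Type*) [Field 𝕜] (q : 𝕜) : Type _ := RingQuot (UqRel 𝕜 q)

/-- The Chevalley generators as elements of `U_q(sl₂)`. -/
noncomputable def Uq.gen (𝕜 : Type*) [Field 𝕜] (q : 𝕜) (g : UqGen) : Uq 𝕜 q :=
  RingQuot.mkAlgHom 𝕜 (UqRel 𝕜 q) (FreeAlgebra.ι 𝕜 g)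

/-! The subspaces `U n` grade `V`, and on `U n` the raising map is `A - θ n`, because `θ n` is
exactly the value of `a K + a⁻¹ K⁻¹` there. Hence `R ^ m` acts on `U i` as `τ i (i + m)` evaluated
at `A`, and kernels of powers of `R` are read off from sums of eigenspaces of `A`.

The grading comes from irreducibility (`iSup_splitPart_eq`). The same argument with the eigenvalues
of `A` in reverse order makes `R ^ (d - 2i)` injective from `U i` to `U (d - i)`. A dimension count
makes it bijective, so `R` behaves like a Lefschetz operator (`TDSystem.isLefschetz`). Its primitive
vectors of degree `i` are exactly those of `lowest i` (`lowest_eq_primitivePart`), and `V` is the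
direct sum of the spaces `R ^ n (lowest i)` with `2i + n ≤ d`. Prescribing `ψ` on these strings
gives existence and uniqueness.

On each string, `ψ` and `R` have the coefficients of a highest weight module, so the relations
reduce to an identity of quantum integers (`loweringCoeff_succ_sub`). -/

open Module.End

/-! ### Sums of eigenspaces indexed by a predicate. -/

section EigenspaceSums

variable {𝕜 V : Type*} [Field 𝕜] [AddCommGroup V] [Module 𝕜 V] {d : ℕ}

/-- The sum of the eigenspaces of `A` for those `θ j` whose index satisfies `p`. -/
def eigSum (A : Module.End 𝕜 V) (θ : Fin (d + 1) → 𝕜) (p : ℕ → Prop) : Submodule 𝕜 V :=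
  ⨆ j : Fin (d + 1), ⨆ _ : p j, eigenspace A (θ j)

variable {A B : Module.End 𝕜 V} {θ : Fin (d + 1) → 𝕜} {p r : ℕ → Prop}

theorem eigenspace_le_eigSum (j : Fin (d + 1)) (hj : p j) : eigenspace A (θ j) ≤ eigSum A θ p :=
  le_iSup₂_of_le j hj le_rfl

theorem eigSum_le {W : Submodule 𝕜 V}
    (h : ∀ j : Fin (d + 1), p j → eigenspace A (θ j) ≤ W) : eigSum A θ p ≤ W :=
  iSup₂_le h

theorem eigSum_mono (h : ∀ n ≤ d, p n → r n) : eigSum A θ p ≤ eigSum A θ r :=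
  eigSum_le fun j hj => eigenspace_le_eigSum j (h j (Nat.le_of_lt_succ j.2) hj)

theorem eigSum_eq_bot (h : ∀ n ≤ d, ¬ p n) : eigSum A θ p = ⊥ :=
  eq_bot_iff.2 (eigSum_le fun j hj => absurd hj (h j (Nat.le_of_lt_succ j.2)))

/-- `A - θ n` annihilates the `n`-th eigenspace and preserves the others, so the index `n` may be
dropped. -/
theorem sub_smul_mem_eigSum (n : Fin (d + 1)) (h : ∀ j, p j → j ≠ n → r j) {v : V}
    (hv : v ∈ eigSum A θ p) : A v - θ n • v ∈ eigSum A θ r := by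
  suffices H : eigSum A θ p ≤ (eigSum A θ r).comap (A - θ n • LinearMap.id) by
    simpa using H hv
  refine eigSum_le fun j hj w hw => ?_
  have hw' := mem_eigenspace_iff.1 hw
  by_cases hjn : j = n
  · subst hjn; simp [hw']
  · have : w ∈ eigSum A θ r :=
      eigenspace_le_eigSum j (h j hj fun h => hjn (Fin.ext h)) hw
    simpa [hw'] using sub_mem (Submodule.smul_mem _ (θ j) this) (Submodule.smul_mem _ (θ n) this)

theorem IsStandardOrdering.apply_mem_eigSum (hs : IsStandardOrdering A B θ)
    (h : ∀ j k, p j → k ≤ j + 1 → j ≤ k + 1 → r k) {v : V} (hv : v ∈ eigSum A θ p) :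
    B v ∈ eigSum A θ r := by
  suffices H : eigSum A θ p ≤ (eigSum A θ r).comap B from H hv
  refine eigSum_le fun j hj w hw => ?_
  refine (iSup₂_le fun k hk => ?_ :
    (⨆ k : Fin (d + 1), ⨆ _ : (k : ℕ) ≤ (j : ℕ) + 1 ∧ (j : ℕ) ≤ (k : ℕ) + 1,
      eigenspace A (θ k)) ≤ eigSum A θ r) (hs.tridiagonal j w hw)
  exact eigenspace_le_eigSum k (h j k hj hk.1 hk.2)

theorem IsStandardOrdering.eigSum_true (hs : IsStandardOrdering A B θ)
    (hA : IsDiagonalizableMap A) : eigSum A θ (fun _ => True) = ⊤ := by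
  rw [eq_top_iff, ← hA]
  refine iSup_le fun μ => ?_
  by_cases h : HasEigenvalue A μ
  · obtain ⟨i, rfl⟩ := (hs.hasEigenvalue_iff μ).1 h
    exact eigenspace_le_eigSum i trivial
  · have : eigenspace A μ = ⊥ := not_not.1 fun h' => h (Module.End.hasEigenvalue_iff.2 h')
    simp [this]

theorem IsStandardOrdering.eigenspace_ne_bot (hs : IsStandardOrdering A B θ) (i : Fin (d + 1)) :
    eigenspace A (θ i) ≠ ⊥ :=
  Module.End.hasEigenvalue_iff.1 ((hs.hasEigenvalue_iff _).2 ⟨i, rfl⟩)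

theorem disjoint_eigSum (hθ : Function.Injective θ) (h : ∀ n, p n → ¬ r n) :
    Disjoint (eigSum A θ p) (eigSum A θ r) := by
  have := ((eigenspaces_iSupIndep A).comp hθ).disjoint_biSup_biSup
    (s := {j : Fin (d + 1) | p j}) (t := {j : Fin (d + 1) | r j})
    (Set.disjoint_left.2 fun j hj => h j hj)
  exact this

theorem IsStandardOrdering.isCompl_eigSum (hs : IsStandardOrdering A B θ)
    (hA : IsDiagonalizableMap A) (h : ∀ n, r n ↔ ¬ p n) :
    IsCompl (eigSum A θ p) (eigSum A θ r) := by
  refine ⟨disjoint_eigSum hs.injective fun n hn hr => (h n).1 hr hn, codisjoint_iff.2 ?_⟩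
  rw [eq_top_iff, ← hs.eigSum_true hA]
  refine eigSum_le fun j _ => ?_
  by_cases hj : p j
  · exact le_sup_of_le_left (eigenspace_le_eigSum j hj)
  · exact le_sup_of_le_right (eigenspace_le_eigSum j ((h j).2 hj))

theorem aeval_apply_eigenvector {μ : 𝕜} {v : V} (hv : v ∈ eigenspace A μ)
    (P : Polynomial 𝕜) : Polynomial.aeval A P v = P.eval μ • v := by
  by_cases h : v = 0
  · simp [h]
  · exact aeval_apply_of_hasEigenvector ⟨hv, h⟩

/-- The kernel of a polynomial in a diagonalizable map is the sum of the eigenspaces for its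
roots. -/
theorem IsStandardOrdering.aeval_apply_eq_zero_iff (hs : IsStandardOrdering A B θ)
    (hA : IsDiagonalizableMap A) (P : Polynomial 𝕜)
    (hp : ∀ j : Fin (d + 1), P.eval (θ j) = 0 ↔ p j) (v : V) :
    Polynomial.aeval A P v = 0 ↔ v ∈ eigSum A θ p := by
  constructor
  · intro hv
    have hc := hs.isCompl_eigSum hA (p := p) (r := fun n => ¬ p n) fun _ => Iff.rfl
    obtain ⟨x, hx, y, hy, rfl⟩ := Submodule.mem_sup.1 (hc.sup_eq_top ▸ Submodule.mem_top (x := v))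
    have hx0 : ∀ z ∈ eigSum A θ p, Polynomial.aeval A P z = 0 := by
      refine fun z hz => (eigSum_le fun j hj w hw => ?_ :
        eigSum A θ p ≤ LinearMap.ker (Polynomial.aeval A P)) hz
      rw [LinearMap.mem_ker, aeval_apply_eigenvector hw, (hp j).2 hj, zero_smul]
    rw [map_add, hx0 x hx, zero_add] at hv
    suffices y = 0 by simpa [this] using hx
    classical
    -- `S` kills the component `y` outside `p` and is coprime to `P`; as `P` kills `y` too, Bézout
    -- gives `y = 0`.
    let S : Polynomial 𝕜 :=
      ∏ j ∈ Finset.univ.filter (fun j : Fin (d + 1) => ¬ p j), (Polynomial.X - Polynomial.C (θ j))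
    have hS : ∀ j : Fin (d + 1), ¬ p j → S.eval (θ j) = 0 := fun j hj => by
      rw [Polynomial.eval_prod]
      exact Finset.prod_eq_zero (i := j) (by simpa using hj) (by simp)
    have hSy : Polynomial.aeval A S y = 0 := by
      refine (eigSum_le fun j hj w hw => ?_ :
        eigSum A θ (fun n => ¬ p n) ≤ LinearMap.ker (Polynomial.aeval A S)) hy
      rw [LinearMap.mem_ker, aeval_apply_eigenvector hw, hS j hj, zero_smul]
    have hcop : IsCoprime S P := IsCoprime.prod_left fun j hj => by
      rw [(Polynomial.irreducible_X_sub_C (θ j)).coprime_iff_not_dvd, Polynomial.dvd_iff_isRoot,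
        Polynomial.IsRoot, hp]
      simpa using hj
    obtain ⟨F, G, hFG⟩ := hcop
    have := congrArg (fun T => Polynomial.aeval A T y) hFG
    simpa [hSy, hv] using this.symm
  · intro hv
    refine (eigSum_le fun j hj w hw => ?_ :
        eigSum A θ p ≤ LinearMap.ker (Polynomial.aeval A P)) hv
    rw [LinearMap.mem_ker, aeval_apply_eigenvector hw, (hp j).2 hj, zero_smul]

theorem eigSum_rev : eigSum A (θ ∘ Fin.rev) p = eigSum A θ (fun n => p (d - n)) := by
  have hval : ∀ j : Fin (d + 1), d - (j.rev : ℕ) = j := fun j => by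
    rw [Fin.val_rev]; have := j.2; omega
  apply le_antisymm
  · refine eigSum_le fun j hj => ?_
    have hj' : p (d - (j.rev : ℕ)) := by rwa [hval j]
    exact eigenspace_le_eigSum (A := A) (θ := θ) (p := fun n => p (d - n)) j.rev hj'
  · refine eigSum_le fun j hj => ?_
    have hj' : p (j.rev : ℕ) := by rw [← hval j.rev, Fin.rev_rev]; exact hj
    have := eigenspace_le_eigSum (A := A) (θ := θ ∘ Fin.rev) (p := p) j.rev hj'
    rwa [Function.comp, Fin.rev_rev] at this

theorem IsStandardOrdering.rev (hs : IsStandardOrdering A B θ) :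
    IsStandardOrdering A B (θ ∘ Fin.rev) where
  injective := hs.injective.comp Fin.rev_injective
  hasEigenvalue_iff μ := (hs.hasEigenvalue_iff μ).trans
    ⟨fun ⟨i, hi⟩ => ⟨i.rev, by simpa using hi⟩, fun ⟨i, hi⟩ => ⟨i.rev, hi⟩⟩
  tridiagonal i v hv := by
    have hv' : v ∈ eigSum A θ (fun n => n = (i.rev : ℕ)) :=
      eigenspace_le_eigSum (θ := θ) (p := fun n => n = (i.rev : ℕ)) i.rev rfl hv
    have hi : (i : ℕ) = d - (i.rev : ℕ) := by rw [Fin.val_rev]; have := i.2; omega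
    have := hs.apply_mem_eigSum
      (r := fun k => d - k ≤ (i : ℕ) + 1 ∧ (i : ℕ) ≤ d - k + 1)
      (fun j k hj h1 h2 => by rw [hi, ← hj]; omega) hv'
    exact (eigSum_rev (p := fun n => n ≤ (i : ℕ) + 1 ∧ (i : ℕ) ≤ n + 1)).ge this

end EigenspaceSums

/-! ### Linear maps prescribed on a direct sum. -/

section LinearMapsFromPieces

theorem LinearMap.lsum_pi_single {𝕜 V ι : Type*} [Field 𝕜] [AddCommGroup V] [Module 𝕜 V]
    [Fintype ι] [DecidableEq ι] {M : ι → Type*} [∀ i, AddCommGroup (M i)] [∀ i, Module 𝕜 (M i)]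
    (f : ∀ i, M i →ₗ[𝕜] V) (i : ι) (x : M i) :
    LinearMap.lsum 𝕜 M 𝕜 f (Pi.single i x) = f i x := by
  rw [LinearMap.lsum_apply, LinearMap.sum_apply, Finset.sum_eq_single i]
  · simp
  · intro j _ hj; simp [Pi.single_eq_of_ne hj]
  · simp

variable {𝕜 V ι : Type*} [Field 𝕜] [AddCommGroup V] [Module 𝕜 V] [Fintype ι]
  {M : ι → Type*} [∀ i, AddCommGroup (M i)] [∀ i, Module 𝕜 (M i)]

/-- If `V` is the direct sum of the images of the injective maps `s i`, then a linear map may be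
prescribed on each of these images. -/
theorem exists_linearMap_of_pieces (s : ∀ i, M i →ₗ[𝕜] V)
    (hinj : ∀ v : ∀ i, M i, ∑ i, s i (v i) = 0 → v = 0)
    (hsurj : ⨆ i, LinearMap.range (s i) = ⊤) (f : ∀ i, M i →ₗ[𝕜] V) :
    ∃ F : Module.End 𝕜 V, ∀ i x, F (s i x) = f i x := by
  classical
  let S : (∀ i, M i) →ₗ[𝕜] V := LinearMap.lsum 𝕜 M 𝕜 s
  have hS : Function.Bijective S := by
    constructor
    · rw [injective_iff_map_eq_zero]
      intro v hv
      exact hinj v (by simpa [S, LinearMap.lsum_apply] using hv)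
    · rw [← LinearMap.range_eq_top, eq_top_iff, ← hsurj]
      refine iSup_le fun i => ?_
      rintro _ ⟨x, rfl⟩
      exact ⟨Pi.single i x, LinearMap.lsum_pi_single s i x⟩
  let e := LinearEquiv.ofBijective S hS
  refine ⟨LinearMap.lsum 𝕜 M 𝕜 f ∘ₗ e.symm.toLinearMap, fun i x => ?_⟩
  have : e.symm (s i x) = Pi.single i x := by
    rw [LinearEquiv.symm_apply_eq]
    exact (LinearMap.lsum_pi_single s i x).symm
  simp only [LinearMap.comp_apply, LinearEquiv.coe_coe, this, LinearMap.lsum_pi_single]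

end LinearMapsFromPieces

/-! ### Gradings and the Lefschetz decomposition. -/

/-- `V` is the direct sum of the subspaces `U 0, …, U d`. -/
structure IsGradedBy {𝕜 V : Type*} [Field 𝕜] [AddCommGroup V] [Module 𝕜 V]
    (U : ℕ → Submodule 𝕜 V) (d : ℕ) : Prop where
  eq_bot : ∀ n, d < n → U n = ⊥
  iSup_eq_top : ⨆ n, U n = ⊤
  eq_zero : ∀ u : ℕ → V, (∀ n, u n ∈ U n) → ∑ n ∈ Finset.range (d + 1), u n = 0 →
    ∀ n, u n = 0

/-- A grading `V = U 0 ⊕ ⋯ ⊕ U d` with a raising map `R` such that `R ^ (d - 2 * i)` maps `U i`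
bijectively to `U (d - i)` for `2 * i ≤ d`. -/
structure IsLefschetz {𝕜 V : Type*} [Field 𝕜] [AddCommGroup V] [Module 𝕜 V]
    (U : ℕ → Submodule 𝕜 V) (R : Module.End 𝕜 V) (d : ℕ) : Prop extends IsGradedBy U d where
  raise : ∀ n, ∀ v ∈ U n, R v ∈ U (n + 1)
  pow_injective : ∀ i, 2 * i ≤ d → ∀ v ∈ U i, (R ^ (d - 2 * i)) v = 0 → v = 0
  pow_surjective : ∀ i, 2 * i ≤ d → ∀ w ∈ U (d - i), ∃ v ∈ U i, (R ^ (d - 2 * i)) v = w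

namespace IsGradedBy

variable {𝕜 V : Type*} [Field 𝕜] [AddCommGroup V] [Module 𝕜 V] {d : ℕ}
  {U : ℕ → Submodule 𝕜 V} (h : IsGradedBy U d)
include h

theorem exists_scalar_map (c : ℕ → 𝕜) : ∃ F : Module.End 𝕜 V, ∀ n, ∀ v ∈ U n, F v = c n • v := by
  refine (exists_linearMap_of_pieces (fun i : Fin (d + 1) => (U i).subtype)
    (fun v hv => ?_) ?_ (fun i => c i • (U i).subtype)).elim fun F hF => ?_
  rotate_left 2
  · refine ⟨F, fun n v hv => ?_⟩
    rcases Nat.lt_or_ge d n with hn | hn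
    · rw [h.eq_bot n hn, Submodule.mem_bot] at hv
      simp [hv]
    · exact hF ⟨n, by omega⟩ ⟨v, hv⟩
  · have := h.eq_zero (fun n => if hn : n < d + 1 then (v ⟨n, hn⟩ : V) else 0)
      (fun n => by
        split_ifs with hn
        exacts [(v ⟨n, hn⟩).2, zero_mem _])
      (by
        rw [Finset.sum_range, ← hv]
        exact Finset.sum_congr rfl fun i _ => dif_pos i.2)
    funext i
    have := this i
    rw [dif_pos i.2] at this
    exact Subtype.ext this
  · rw [eq_top_iff, ← h.iSup_eq_top]
    refine iSup_le fun n => ?_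
    rcases Nat.lt_or_ge d n with hn | hn
    · simp [h.eq_bot n hn]
    · exact le_iSup_of_le ⟨n, by omega⟩ (by simp)

/-- Linear maps that agree on each `U n` are equal. -/
theorem ext_grading {F G : Module.End 𝕜 V} (hFG : ∀ n ≤ d, ∀ v ∈ U n, F v = G v) : F = G := by
  have : (⊤ : Submodule 𝕜 V) ≤ LinearMap.eqLocus F G := by
    rw [← h.iSup_eq_top]
    refine iSup_le fun n v hv => ?_
    rcases Nat.lt_or_ge d n with hn | hn
    · rw [h.eq_bot n hn, Submodule.mem_bot] at hv
      simp [hv]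
    · exact hFG n hn v hv
  exact LinearMap.ext fun v => this (Submodule.mem_top (x := v))

end IsGradedBy

/-- The primitive part of degree `i` of a Lefschetz grading. -/
def primitivePart {𝕜 V : Type*} [Field 𝕜] [AddCommGroup V] [Module 𝕜 V]
    (U : ℕ → Submodule 𝕜 V) (R : Module.End 𝕜 V) (d i : ℕ) : Submodule 𝕜 V :=
  U i ⊓ LinearMap.ker (R ^ (d - 2 * i + 1))

namespace IsLefschetz

variable {𝕜 V : Type*} [Field 𝕜] [AddCommGroup V] [Module 𝕜 V] {d : ℕ}
  {U : ℕ → Submodule 𝕜 V} {R : Module.End 𝕜 V} (h : IsLefschetz U R d)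
include h

theorem pow_mem (k : ℕ) {n : ℕ} {v : V} (hv : v ∈ U n) : (R ^ k) v ∈ U (n + k) := by
  induction k with
  | zero => simpa using hv
  | succ k ih =>
    rw [pow_succ', Module.End.mul_apply]
    exact h.raise _ _ ih

omit h in
theorem pow_apply_eq_zero {i k : ℕ} {v : V} (hv : v ∈ primitivePart U R d i)
    (hk : d - 2 * i + 1 ≤ k) : (R ^ k) v = 0 := by
  obtain ⟨m, rfl⟩ := Nat.exists_eq_add_of_le' hk
  rw [pow_add, Module.End.mul_apply, show (R ^ (d - 2 * i + 1)) v = 0 from hv.2, map_zero]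

/-- The Lefschetz decomposition: `V` is spanned by the images of the primitive parts. -/
theorem eq_top_of_pow_mem {S : Submodule 𝕜 V}
    (hS : ∀ i n, 2 * i + n ≤ d → ∀ v ∈ primitivePart U R d i, (R ^ n) v ∈ S) : S = ⊤ := by
  have hS' : ∀ i n, 2 * i ≤ d → ∀ v ∈ primitivePart U R d i, (R ^ n) v ∈ S := by
    intro i n hi v hv
    rcases Nat.lt_or_ge d (2 * i + n) with hn | hn
    · rw [pow_apply_eq_zero hv (by omega)]; exact zero_mem _
    · exact hS i n hn v hv
  have lower : ∀ j, 2 * j ≤ d → ∀ u ∈ U j, ∀ n, (R ^ n) u ∈ S := by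
    intro j
    induction j with
    | zero =>
      intro _ u hu n
      refine hS' 0 n (by omega) u ⟨hu, ?_⟩
      -- All of `U 0` is primitive, since `R ^ (d + 1)` pushes it past degree `d`.
      have := h.pow_mem (d - 2 * 0 + 1) hu
      rwa [h.eq_bot _ (by omega), Submodule.mem_bot] at this
    | succ j ih =>
      intro hj u hu n
      -- This power of `R` sends `u` into `U (d - j)`, which is also the image of `U j` under one
      -- more power of `R`. Subtracting a suitable `R w` with `w ∈ U j` therefore leaves a primitive
      -- vector.
      have h1 := h.pow_mem (d - 2 * (j + 1) + 1) hu
      rw [show j + 1 + (d - 2 * (j + 1) + 1) = d - j by omega] at h1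
      obtain ⟨w, hw, hwu⟩ := h.pow_surjective j (by omega) _ h1
      have h2 : u - R w ∈ primitivePart U R d (j + 1) := by
        refine ⟨sub_mem hu (h.raise _ _ hw), ?_⟩
        rw [SetLike.mem_coe, LinearMap.mem_ker, map_sub, ← Module.End.mul_apply, ← pow_succ,
          show d - 2 * (j + 1) + 1 + 1 = d - 2 * j by omega, hwu, sub_self]
      have h3 := add_mem (hS' (j + 1) n hj _ h2) (ih (by omega) w hw (n + 1))
      rwa [pow_succ, Module.End.mul_apply, ← map_add, sub_add_cancel] at h3
  rw [eq_top_iff, ← h.iSup_eq_top]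
  refine iSup_le fun j v hv => ?_
  rcases Nat.lt_or_ge d j with hj | hj
  · rw [h.eq_bot j hj, Submodule.mem_bot] at hv
    rw [hv]; exact zero_mem _
  rcases Nat.lt_or_ge d (2 * j) with hj2 | hj2
  · obtain ⟨u, hu, rfl⟩ := h.pow_surjective (d - j) (by omega) v
      (by rwa [show d - (d - j) = j by omega])
    exact lower _ (by omega) u hu _
  · simpa using lower j hj2 v hv 0

/-- Linear maps that agree on the images of the primitive parts are equal. -/
theorem ext_primitive {F G : Module.End 𝕜 V}
    (hFG : ∀ i n, 2 * i + n ≤ d → ∀ v ∈ primitivePart U R d i, F ((R ^ n) v) = G ((R ^ n) v)) :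
    F = G := by
  have : LinearMap.eqLocus F G = ⊤ := h.eq_top_of_pow_mem hFG
  exact LinearMap.ext fun v => this.ge (Submodule.mem_top (x := v))

/-- The images of the primitive parts are independent. -/
theorem eq_zero_of_sum_pow_eq_zero (v : ℕ → ℕ → V)
    (hv : ∀ i n, v i n ∈ primitivePart U R d i)
    (h0 : ∀ i n, d < 2 * i + n → v i n = 0)
    (hsum : ∑ j ∈ Finset.range (d + 1), ∑ i ∈ Finset.range (j + 1), (R ^ (j - i)) (v i (j - i)) = 0)
    (i n : ℕ) : v i n = 0 := by
  have hj := h.eq_zero (fun j => ∑ i ∈ Finset.range (j + 1), (R ^ (j - i)) (v i (j - i)))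
    (fun j => Submodule.sum_mem _ fun i hi => by
      have hi := Finset.mem_range.1 hi
      have := h.pow_mem (j - i) (hv i (j - i)).1
      rwa [show i + (j - i) = j by omega] at this) hsum
  induction i using Nat.strong_induction_on generalizing n with
  | _ i ih =>
    rcases Nat.lt_or_ge d (2 * i + n) with hn | hn
    · exact h0 i n hn
    -- In degree `i + n` the terms with index below `i` vanish by induction. This power of `R` kills
    -- those with index `k > i`, whose total exponent `d - i - k` is at least `d - 2k + 1`. Only `R
    -- ^ (d - 2i)` applied to `v i n` survives.
    have h1 := congrArg (R ^ (d - 2 * i - n)) (hj (i + n))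
    simp only [map_sum, map_zero] at h1
    rw [Finset.sum_eq_single i] at h1
    · rw [← Module.End.mul_apply, ← pow_add, show i + n - i = n by omega,
        show d - 2 * i - n + n = d - 2 * i by omega] at h1
      exact h.pow_injective i (by omega) _ (hv i n).1 h1
    · intro k hk hki
      have hk := Finset.mem_range.1 hk
      rcases Nat.lt_or_ge k i with hlt | hge
      · rw [ih k hlt, map_zero, map_zero]
      · rw [← Module.End.mul_apply, ← pow_add]
        rcases Nat.lt_or_ge d (2 * k + (i + n - k)) with hd | hd
        · rw [h0 _ _ hd, map_zero]
        · exact pow_apply_eq_zero (hv k _) (by omega)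
    · intro hi; exact absurd (Finset.mem_range.2 (by omega)) hi

/-- A linear map may be prescribed on the images of the primitive parts. -/
theorem exists_lowering (c : ℕ → ℕ → 𝕜) : ∃ F : Module.End 𝕜 V, ∀ i n, 2 * i + n ≤ d →
    ∀ v ∈ primitivePart U R d i, F ((R ^ n) v) = c i n • (R ^ (n - 1)) v := by
  classical
  let I := {x : Fin (d + 1) × Fin (d + 1) // 2 * (x.1 : ℕ) + x.2 ≤ d}
  refine (exists_linearMap_of_pieces (ι := I)
    (fun x => (R ^ (x.1.2 : ℕ)) ∘ₗ (primitivePart U R d x.1.1).subtype) (fun v hv => ?_) ?_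
    (fun x => c x.1.1 x.1.2 •
      ((R ^ ((x.1.2 : ℕ) - 1)) ∘ₗ (primitivePart U R d x.1.1).subtype))).elim fun F hF => ?_
  rotate_left 2
  · refine ⟨F, fun i n hin v hv => ?_⟩
    exact hF ⟨(⟨i, by omega⟩, ⟨n, by omega⟩), hin⟩ ⟨v, hv⟩
  · let w : ℕ → ℕ → V := fun i n =>
      if hx : 2 * i + n ≤ d then
        (v ⟨(⟨i, by omega⟩, ⟨n, by omega⟩), hx⟩ : V) else 0
    have hw := h.eq_zero_of_sum_pow_eq_zero w
      (fun i n => by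
        dsimp only [w]
        split_ifs with hx
        exacts [(v ⟨(⟨i, by omega⟩, ⟨n, by omega⟩), hx⟩).2, zero_mem _])
      (fun i n hx => dif_neg (by omega)) ?_
    · funext x
      have := hw x.1.1 x.1.2
      simp only [w, dif_pos x.2] at this
      exact Subtype.ext this
    · rw [← hv, Finset.sum_sigma']
      symm
      -- A pair `(i, n)` corresponds to total degree `j = i + n` together with `i`. Pairs `(j, i)`
      -- with `i + j > d` have no counterpart in `I`, but `w` vanishes there.
      refine Finset.sum_bij_ne_zero
        (fun x _ _ => ⟨(x.1.1 : ℕ) + x.1.2, (x.1.1 : ℕ)⟩) ?_ ?_ ?_ ?_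
      · rintro x - -
        have := x.2
        refine Finset.mem_sigma.2 ⟨Finset.mem_range.2 ?_, Finset.mem_range.2 ?_⟩ <;>
          dsimp only <;> omega
      · rintro ⟨⟨x1, x2⟩, hx⟩ - - ⟨⟨y1, y2⟩, hy⟩ - - hxy
        simp only [Sigma.mk.injEq, heq_eq_eq] at hxy
        exact Subtype.ext (Prod.ext (Fin.ext (by dsimp only; omega)) (Fin.ext (by dsimp only; omega)))
      · rintro ⟨j, i⟩ hb hne
        have hb1 := Finset.mem_range.1 (Finset.mem_sigma.1 hb).1
        have hb2 := Finset.mem_range.1 (Finset.mem_sigma.1 hb).2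
        dsimp only at hb1 hb2
        have hx : 2 * i + (j - i) ≤ d := by
          by_contra hx
          exact hne (by simp only [w, dif_neg hx, map_zero])
        refine ⟨⟨(⟨i, by omega⟩, ⟨j - i, by omega⟩), hx⟩, Finset.mem_univ _, ?_, ?_⟩
        · simp only [w, dif_pos hx] at hne
          exact hne
        · simp only [Sigma.mk.injEq, heq_eq_eq, and_true]; omega
      · rintro x - -
        have : (x.1.1 : ℕ) + x.1.2 - x.1.1 = x.1.2 := by omega
        simp only [this, w, dif_pos x.2]
        rfl
  · refine h.eq_top_of_pow_mem fun i n hin v hv => ?_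
    exact Submodule.mem_iSup_of_mem ⟨(⟨i, by omega⟩, ⟨n, by omega⟩), hin⟩ ⟨⟨v, hv⟩, rfl⟩

end IsLefschetz

/-! ### The split decomposition and its dimensions. -/

/-- A pair of diagonalizable maps acting irreducibly, with a standard ordering of the eigenvalues
of each of them and equal diameters. -/
structure IsTDSequence {𝕜 V : Type*} [Field 𝕜] [AddCommGroup V] [Module 𝕜 V] {d : ℕ}
    (A B : Module.End 𝕜 V) (α β : Fin (d + 1) → 𝕜) : Prop where
  diag : IsDiagonalizableMap A
  diag_star : IsDiagonalizableMap B
  standard : IsStandardOrdering A B α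
  standard_star : IsStandardOrdering B A β
  irreducible : ∀ W : Submodule 𝕜 V,
    (∀ v ∈ W, A v ∈ W) → (∀ v ∈ W, B v ∈ W) → W = ⊥ ∨ W = ⊤

/-- The component `(V*₀ + ⋯ + V*ₙ) ∩ (Vₙ₊ᵣ + ⋯ + V_d)`; for `r = 0` this is the split
decomposition. -/
def splitPart {𝕜 V : Type*} [Field 𝕜] [AddCommGroup V] [Module 𝕜 V] {d : ℕ}
    (A B : Module.End 𝕜 V) (α β : Fin (d + 1) → 𝕜) (r n : ℕ) : Submodule 𝕜 V :=
  eigSum B β (· ≤ n) ⊓ eigSum A α (n + r ≤ ·)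

namespace IsTDSequence

variable {𝕜 V : Type*} [Field 𝕜] [AddCommGroup V] [Module 𝕜 V] {d : ℕ}
  {A B : Module.End 𝕜 V} {α β : Fin (d + 1) → 𝕜} (h : IsTDSequence A B α β)
include h

/-- Every result below thereby also holds for the reversed ordering, which compares the same sums of
eigenspaces of `B` with initial rather than final sums for `A`. -/
theorem rev : IsTDSequence A B (α ∘ Fin.rev) β :=
  ⟨h.diag, h.diag_star, h.standard.rev, h.standard_star, h.irreducible⟩

omit h in
theorem splitPart_eq_bot {r n : ℕ} (hn : d < n + r) : splitPart A B α β r n = ⊥ := by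
  rw [splitPart, eigSum_eq_bot (p := (n + r ≤ ·)) (fun k hk hk' => by omega), inf_bot_eq]

theorem raise_splitPart {r n : ℕ} (hn : n + r < d + 1) {v : V}
    (hv : v ∈ splitPart A B α β r n) :
    A v - α ⟨n + r, hn⟩ • v ∈ splitPart A B α β r (n + 1) := by
  refine ⟨sub_mem ?_ (Submodule.smul_mem _ _ ?_), ?_⟩
  · exact h.standard_star.apply_mem_eigSum (fun j k hj hk _ => by omega) hv.1
  · exact eigSum_mono (fun k _ hk => by omega) hv.1
  · refine sub_smul_mem_eigSum ⟨n + r, hn⟩ (fun j hj hjn => ?_) hv.2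
    dsimp only at hjn; omega

theorem lower_splitPart_succ {r n : ℕ} (hn : n + 1 < d + 1) {v : V}
    (hv : v ∈ splitPart A B α β r (n + 1)) :
    B v - β ⟨n + 1, hn⟩ • v ∈ splitPart A B α β r n := by
  refine ⟨?_, sub_mem ?_ (Submodule.smul_mem _ _ ?_)⟩
  · refine sub_smul_mem_eigSum ⟨n + 1, hn⟩ (fun j hj hjn => ?_) hv.1
    dsimp only at hjn; omega
  · exact h.standard.apply_mem_eigSum (fun j k hj hk _ => by omega) hv.2
  · exact eigSum_mono (fun k _ hk => by omega) hv.2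

omit h in
theorem lower_splitPart_zero {r : ℕ} {v : V} (hv : v ∈ splitPart A B α β r 0) :
    B v = β 0 • v := by
  have : B v - β 0 • v ∈ eigSum B β (fun _ => False) :=
    sub_smul_mem_eigSum 0 (fun j hj hj0 => hj0 (Nat.le_zero.1 hj)) hv.1
  rw [eigSum_eq_bot fun _ _ => id, Submodule.mem_bot] at this
  exact sub_eq_zero.1 this

/-- A shift of `A` by a scalar raises the index `n` by one and a shift of `B` lowers it by one, so
the sum is invariant under both maps and irreducibility applies. -/
theorem iSup_splitPart_eq (r : ℕ) :
    (⨆ n, splitPart A B α β r n) = ⊥ ∨ (⨆ n, splitPart A B α β r n) = ⊤ := by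
  have le := le_iSup (splitPart A B α β r)
  refine h.irreducible _ (fun v hv => ?_) fun v hv => ?_
  · refine (iSup_le fun n w hw => ?_ : _ ≤ (⨆ n, splitPart A B α β r n).comap A) hv
    rcases Nat.lt_or_ge (n + r) (d + 1) with hn | hn
    · simpa using add_mem (le _ (h.raise_splitPart hn hw))
        (Submodule.smul_mem _ (α ⟨n + r, hn⟩) (le _ hw))
    · rw [splitPart_eq_bot (by omega), Submodule.mem_bot] at hw
      simp [hw]
  · refine (iSup_le fun n w hw => ?_ : _ ≤ (⨆ n, splitPart A B α β r n).comap B) hv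
    rcases Nat.lt_or_ge (n + r) (d + 1) with hn | hn
    · rcases n with _ | n
      · rw [Submodule.mem_comap, lower_splitPart_zero hw]
        exact Submodule.smul_mem _ _ (le _ hw)
      · simpa using add_mem (le _ (h.lower_splitPart_succ (by omega) hw))
          (Submodule.smul_mem _ (β ⟨n + 1, by omega⟩) (le _ hw))
    · rw [splitPart_eq_bot (by omega), Submodule.mem_bot] at hw
      simp [hw]

theorem disjoint_lt_ge (n : ℕ) : Disjoint (eigSum B β (· < n)) (eigSum A α (n ≤ ·)) := by
  rcases n with _ | n
  · rw [eigSum_eq_bot (p := (· < 0)) fun k _ => Nat.not_lt_zero k]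
    exact disjoint_bot_left
  -- For `r = 1` the sum misses the eigenspace of `α 0`, so it is not all of `V`.
  have hbot : (⨆ n, splitPart A B α β 1 n) = ⊥ := by
    refine (h.iSup_splitPart_eq 1).resolve_right fun htop => h.standard.eigenspace_ne_bot 0 ?_
    have hle : (⨆ n, splitPart A B α β 1 n) ≤ eigSum A α (1 ≤ ·) :=
      iSup_le fun n => inf_le_right.trans (eigSum_mono fun k _ hk => by omega)
    have hdis : Disjoint (eigSum A α (· = 0)) (eigSum A α (1 ≤ ·)) :=
      disjoint_eigSum h.standard.injective fun k hk => by omega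
    rw [htop, top_le_iff] at hle
    rw [hle, disjoint_top] at hdis
    exact eq_bot_iff.2 ((eigenspace_le_eigSum (p := (· = 0)) 0 rfl).trans hdis.le)
  rw [disjoint_iff, eq_bot_iff, ← hbot]
  exact (inf_le_inf_right _ (eigSum_mono fun k _ hk => by omega)).trans
    (le_iSup (splitPart A B α β 1) n)

/-- For `r = 0` the sum contains the nonzero eigenspace of `β 0`. -/
theorem iSup_splitPart : (⨆ n, splitPart A B α β 0 n) = ⊤ := by
  refine (h.iSup_splitPart_eq 0).resolve_left fun hbot => h.standard_star.eigenspace_ne_bot 0 ?_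
  rw [eq_bot_iff, ← hbot]
  have h0 : eigenspace B (β 0) ≤ eigSum B β (· ≤ 0) := eigenspace_le_eigSum (p := (· ≤ 0)) 0 le_rfl
  refine le_trans (le_inf h0 ?_) (le_iSup (splitPart A B α β 0) 0)
  rw [show eigSum A α (0 + 0 ≤ ·) = ⊤ from
    eq_top_iff.2 ((h.standard.eigSum_true h.diag).ge.trans (eigSum_mono fun k _ _ => by omega))]
  exact le_top

theorem isCompl_lt_ge (n : ℕ) : IsCompl (eigSum B β (· < n)) (eigSum A α (n ≤ ·)) := by
  refine ⟨h.disjoint_lt_ge n, codisjoint_iff.2 (eq_top_iff.2 ?_)⟩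
  rw [← h.iSup_splitPart]
  refine iSup_le fun k => ?_
  rcases Nat.lt_or_ge k n with hk | hk
  · exact le_sup_of_le_left (inf_le_left.trans (eigSum_mono fun j _ hj => by omega))
  · exact le_sup_of_le_right (inf_le_right.trans (eigSum_mono fun j _ hj => by omega))

theorem splitPart_eq_zero_of_sum (u : ℕ → V) (hu : ∀ n, u n ∈ splitPart A B α β 0 n)
    (hsum : ∑ n ∈ Finset.range (d + 1), u n = 0) (n : ℕ) : u n = 0 := by
  induction n using Nat.strong_induction_on with
  | _ n ih =>
    rcases Nat.lt_or_ge d n with hn | hn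
    · have := hu n
      rwa [splitPart_eq_bot (by omega), Submodule.mem_bot] at this
    have h1 : u n ∈ eigSum B β (· < n + 1) :=
      eigSum_mono (fun k _ hk => by omega) (hu n).1
    rw [← Finset.add_sum_erase _ _ (Finset.mem_range.2 (by omega : n < d + 1)),
      add_eq_zero_iff_eq_neg] at hsum
    -- Earlier terms vanish by induction, so `u n` is minus a sum of later ones.
    have h2 : u n ∈ eigSum A α (n + 1 ≤ ·) := by
      rw [hsum]
      refine neg_mem (Submodule.sum_mem _ fun k hk => ?_)
      rcases Nat.lt_or_ge k n with hkn | hkn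
      · rw [ih k hkn]; exact zero_mem _
      · have := Finset.ne_of_mem_erase hk
        exact eigSum_mono (fun j _ hj => by omega) (hu k).2
    exact (Submodule.disjoint_def.1 (h.disjoint_lt_ge (n + 1))) _ h1 h2

variable [FiniteDimensional 𝕜 V]

open Module in
-- Both are complements of `eigSum B β (· < n)`, one for the given ordering and one for its
-- reversal.
theorem finrank_ge_eq_finrank_lt (n : ℕ) :
    finrank 𝕜 (eigSum A α (n ≤ ·)) = finrank 𝕜 (eigSum A α (· < d + 1 - n)) := by
  have h1 := Submodule.finrank_add_eq_of_isCompl (h.isCompl_lt_ge n)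
  have h2 := Submodule.finrank_add_eq_of_isCompl (h.rev.isCompl_lt_ge n)
  rw [eigSum_rev] at h2
  have h3 : eigSum A α (fun k => n ≤ d - k) = eigSum A α (· < d + 1 - n) := by
    rcases Nat.lt_or_ge d n with hn | hn
    · rcases n with _ | n
      · omega
      · rw [eigSum_eq_bot fun k _ => by omega, eigSum_eq_bot fun k _ => by omega]
    · exact le_antisymm (eigSum_mono fun k _ hk => by omega) (eigSum_mono fun k _ hk => by omega)
  rw [h3] at h2
  omega

open Module in
-- By the modular law, `splitPart A B α β 0 n` complements the sum from `n + 1` inside the sum from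
-- `n`. It thus has the dimension of the `n`-th eigenspace of `A`.
theorem finrank_splitPart_add (n : ℕ) :
    finrank 𝕜 (splitPart A B α β 0 n) + finrank 𝕜 (eigSum A α (n + 1 ≤ ·)) =
      finrank 𝕜 (eigSum A α (n ≤ ·)) := by
  have hc := h.isCompl_lt_ge (n + 1)
  have hle : eigSum A α (n + 1 ≤ ·) ≤ eigSum A α (n ≤ ·) :=
    eigSum_mono fun k _ hk => by omega
  have hP : eigSum B β (· < n + 1) = eigSum B β (· ≤ n) :=
    le_antisymm (eigSum_mono fun k _ hk => by omega) (eigSum_mono fun k _ hk => by omega)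
  rw [hP] at hc
  have hd : Disjoint (splitPart A B α β 0 n) (eigSum A α (n + 1 ≤ ·)) :=
    hc.disjoint.mono_left inf_le_left
  have hs : splitPart A B α β 0 n ⊔ eigSum A α (n + 1 ≤ ·) = eigSum A α (n ≤ ·) := by
    rw [splitPart, inf_comm, add_zero, inf_sup_assoc_of_le _ hle, hc.sup_eq_top, inf_top_eq]
  have := Submodule.finrank_sup_add_finrank_inf_eq (splitPart A B α β 0 n)
    (eigSum A α (n + 1 ≤ ·))
  rw [hd.eq_bot, finrank_bot, hs] at this
  omega

open Module in
-- Differences of `finrank_ge_eq_finrank_lt` show that the eigenspaces of `A` numbered `i` and `d -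
-- i` have equal dimension.
theorem finrank_splitPart_sub {i : ℕ} (hi : i ≤ d) :
    finrank 𝕜 (splitPart A B α β 0 (d - i)) = finrank 𝕜 (splitPart A B α β 0 i) := by
  have hcomp : ∀ n, finrank 𝕜 (eigSum A α (· < n)) + finrank 𝕜 (eigSum A α (n ≤ ·)) =
      finrank 𝕜 V := fun n =>
    Submodule.finrank_add_eq_of_isCompl (h.standard.isCompl_eigSum h.diag fun k => by omega)
  have h1 := h.finrank_splitPart_add i
  have h2 := h.finrank_splitPart_add (d - i)
  have h3 := h.finrank_ge_eq_finrank_lt (d - i)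
  have h4 := h.finrank_ge_eq_finrank_lt (d - i + 1)
  rw [show d + 1 - (d - i) = i + 1 by omega] at h3
  rw [show d + 1 - (d - i + 1) = i by omega] at h4
  have h5 := hcomp i
  have h6 := hcomp (i + 1)
  omega

end IsTDSequence

/-! ### The raising map on the split decomposition. -/

namespace TDSystem

variable {𝕜 V : Type*} [Field 𝕜] [AddCommGroup V] [Module 𝕜 V] {d : ℕ} (Φ : TDSystem 𝕜 V d)

theorem isTDSequence : IsTDSequence Φ.A Φ.Astar Φ.θ Φ.θstar :=
  ⟨Φ.isTDPair.diagonalizable, Φ.isTDPair.diagonalizable_star, Φ.standard, Φ.standard_star,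
    Φ.isTDPair.irreducible⟩

/-- The components of the split decomposition, indexed by the natural numbers. -/
def split (n : ℕ) : Submodule 𝕜 V := splitPart Φ.A Φ.Astar Φ.θ Φ.θstar 0 n

theorem range_primitiveIdempotent {A B : Module.End 𝕜 V} {θ : Fin (d + 1) → 𝕜}
    (hs : IsStandardOrdering A B θ) (hA : IsDiagonalizableMap A)
    {E : Fin (d + 1) → Module.End 𝕜 V} (hE : ArePrimitiveIdempotents A θ E) (i : Fin (d + 1)) :
    LinearMap.range (E i) = eigenspace A (θ i) := by
  apply le_antisymm
  · rw [LinearMap.range_eq_map, Submodule.map_le_iff_le_comap, ← hs.eigSum_true hA]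
    refine eigSum_le fun j _ v hv => ?_
    rw [Submodule.mem_comap, hE i j v hv]
    split_ifs with hij
    · rwa [hij]
    · exact zero_mem _
  · exact fun v hv => ⟨v, by rw [hE i i v hv, if_pos rfl]⟩

theorem range_E (i : Fin (d + 1)) : LinearMap.range (Φ.E i) = eigenspace Φ.A (Φ.θ i) :=
  range_primitiveIdempotent Φ.standard Φ.isTDPair.diagonalizable Φ.idempotents i

theorem range_Estar (i : Fin (d + 1)) :
    LinearMap.range (Φ.Estar i) = eigenspace Φ.Astar (Φ.θstar i) :=
  range_primitiveIdempotent Φ.standard_star Φ.isTDPair.diagonalizable_star Φ.idempotents_star i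

theorem U_eq_split (i : Fin (d + 1)) : Φ.U i = Φ.split i := by
  simp only [U, range_E, range_Estar]
  rfl

theorem lowest_eq (i : ℕ) : Φ.lowest i =
    eigSum Φ.Astar Φ.θstar (· ≤ i) ⊓ eigSum Φ.A Φ.θ (fun j => i ≤ j ∧ j + i ≤ d) := by
  simp only [lowest, range_E, range_Estar]
  rfl

theorem eval_τ_eq_zero_iff (i j : ℕ) (k : Fin (d + 1)) :
    (Φ.τ i j).eval (Φ.θ k) = 0 ↔ i ≤ (k : ℕ) ∧ (k : ℕ) < j := by
  rw [τ, Polynomial.eval_prod, Finset.prod_eq_zero_iff]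
  constructor
  · rintro ⟨m, hm, hm0⟩
    rw [Polynomial.eval_sub, Polynomial.eval_X, Polynomial.eval_C, sub_eq_zero] at hm0
    rw [Φ.standard.injective hm0]
    exact (Finset.mem_filter.1 hm).2
  · exact fun hk => ⟨k, Finset.mem_filter.2 ⟨Finset.mem_univ _, hk⟩, by simp⟩

theorem τ_self (i : ℕ) : Φ.τ i i = 1 := by
  rw [τ, Finset.filter_false_of_mem fun x _ => by omega, Finset.prod_empty]

theorem τ_succ {i j : ℕ} (hij : i ≤ j) (hj : j < d + 1) :
    Φ.τ i (j + 1) = (Polynomial.X - Polynomial.C (Φ.θ ⟨j, hj⟩)) * Φ.τ i j := by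
  have : Finset.univ.filter (fun h : Fin (d + 1) => i ≤ (h : ℕ) ∧ (h : ℕ) < j + 1) =
      insert ⟨j, hj⟩ (Finset.univ.filter (fun h : Fin (d + 1) => i ≤ (h : ℕ) ∧ (h : ℕ) < j)) := by
    ext x
    simp only [Finset.mem_filter, Finset.mem_univ, true_and, Finset.mem_insert, Fin.ext_iff]
    omega
  rw [τ, this, Finset.prod_insert (by simp), τ]

theorem isGradedBy : IsGradedBy Φ.split d where
  eq_bot _ hn := IsTDSequence.splitPart_eq_bot (by omega)
  iSup_eq_top := Φ.isTDSequence.iSup_splitPart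
  eq_zero := Φ.isTDSequence.splitPart_eq_zero_of_sum

theorem lowest_le_split (i : ℕ) : Φ.lowest i ≤ Φ.split i := by
  rw [lowest_eq]
  exact inf_le_inf_left _ (eigSum_mono fun k _ hk => hk.1)

section Raising

variable {Φ} {R : Module.End 𝕜 V}
  (hR : ∀ n : Fin (d + 1), ∀ v ∈ Φ.split n, R v = Φ.A v - Φ.θ n • v)
include hR

theorem raise_mem (n : ℕ) (v : V) (hv : v ∈ Φ.split n) : R v ∈ Φ.split (n + 1) := by
  rcases Nat.lt_or_ge d n with hn | hn
  · rw [Φ.isGradedBy.eq_bot n hn, Submodule.mem_bot] at hv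
    rw [hv, map_zero]; exact zero_mem _
  · rw [hR ⟨n, by omega⟩ v hv]
    exact Φ.isTDSequence.raise_splitPart (r := 0) (by omega) hv

theorem pow_raise_mem {i : ℕ} {v : V} (hv : v ∈ Φ.split i) (m : ℕ) :
    (R ^ m) v ∈ Φ.split (i + m) := by
  induction m with
  | zero => simpa using hv
  | succ m ih =>
    rw [pow_succ', Module.End.mul_apply]
    exact raise_mem hR _ _ ih

/-- The factor for `θ (i + m)` meets the vector `(R ^ m) v` of `Φ.split (i + m)`, where it acts as
`R`. -/
theorem aeval_τ_apply {i : ℕ} {v : V} (hv : v ∈ Φ.split i) (m : ℕ) (hm : i + m ≤ d + 1) :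
    Polynomial.aeval Φ.A (Φ.τ i (i + m)) v = (R ^ m) v := by
  induction m with
  | zero => simp [τ_self]
  | succ m ih =>
    rw [← add_assoc, τ_succ Φ (by omega) (by omega), map_mul, Module.End.mul_apply, ih (by omega),
      pow_succ', Module.End.mul_apply, hR ⟨i + m, by omega⟩ _ (pow_raise_mem hR hv m)]
    simp [Algebra.algebraMap_eq_smul_one]

/-- On `Φ.split i` the power of `R` is `τ i (d - i + 1)` at `A`, whose roots are the `θ j` with `i ≤
j ≤ d - i`. -/
theorem lowest_eq_primitivePart {i : ℕ} (hi : 2 * i ≤ d) :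
    Φ.lowest i = primitivePart Φ.split R d i := by
  have key : ∀ v ∈ Φ.split i, ((R ^ (d - 2 * i + 1)) v = 0 ↔
      v ∈ eigSum Φ.A Φ.θ (fun j => i ≤ j ∧ j + i ≤ d)) := fun v hv => by
    rw [← aeval_τ_apply hR hv _ (by omega)]
    refine Φ.standard.aeval_apply_eq_zero_iff Φ.isTDPair.diagonalizable _ (fun k => ?_) v
    rw [eval_τ_eq_zero_iff]
    omega
  ext v
  constructor
  · intro hv
    have hvs := Φ.lowest_le_split i hv
    rw [lowest_eq] at hv
    exact ⟨hvs, (key v hvs).2 hv.2⟩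
  · intro hv
    rw [lowest_eq]
    exact ⟨hv.1.1, (key v hv.1).1 hv.2⟩

theorem isLefschetz [FiniteDimensional 𝕜 V] : IsLefschetz Φ.split R d := by
  have hinj : ∀ i, 2 * i ≤ d → ∀ v ∈ Φ.split i, (R ^ (d - 2 * i)) v = 0 → v = 0 := by
    intro i hi v hv h0
    rw [← aeval_τ_apply hR hv _ (by omega),
      Φ.standard.aeval_apply_eq_zero_iff Φ.isTDPair.diagonalizable
        (p := fun k => i ≤ k ∧ k < i + (d - 2 * i)) _
        (Φ.eval_τ_eq_zero_iff i (i + (d - 2 * i)))] at h0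
    -- The kernel vector lies in the sum of the eigenspaces of `A` numbered `i` to `d - i - 1`.
    -- Disjointness for the reversed ordering separates indices up to `d - i - 1` from `Φ.split i`.
    have hd := Φ.isTDSequence.rev.disjoint_lt_ge (i + 1)
    rw [eigSum_rev] at hd
    exact Submodule.disjoint_def.1 hd v (eigSum_mono (fun k _ hk => by omega) hv.1)
      (eigSum_mono (fun k _ hk => by omega) h0)
  refine ⟨Φ.isGradedBy, raise_mem hR, hinj, fun i hi w hw => ?_⟩
  have hmaps : ∀ v ∈ Φ.split i, (R ^ (d - 2 * i)) v ∈ Φ.split (d - i) := fun v hv => by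
    have := pow_raise_mem hR hv (d - 2 * i)
    rwa [show i + (d - 2 * i) = d - i by omega] at this
  have hsurj := (LinearMap.injective_iff_surjective_of_finrank_eq_finrank
    (f := (R ^ (d - 2 * i)).restrict hmaps)
    (Φ.isTDSequence.finrank_splitPart_sub (by omega : i ≤ d)).symm).1 (by
      rw [injective_iff_map_eq_zero]
      intro v hv
      exact Subtype.ext (hinj i hi v v.2 (congrArg Subtype.val hv)))
  obtain ⟨v, hv⟩ := hsurj ⟨w, hw⟩
  exact ⟨v, v.2, congrArg Subtype.val hv⟩

end Raising

end TDSystem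

/-! ### The relations of the quantum algebra. -/

/-- Maps satisfying the defining relations make `V` a module for `U_q(sl₂)`. -/
theorem exists_module_Uq {𝕜 V : Type*} [Field 𝕜] [AddCommGroup V] [Module 𝕜 V] (q : 𝕜)
    (K : (Module.End 𝕜 V)ˣ) (e f : Module.End 𝕜 V)
    (hKe : (K : Module.End 𝕜 V) * e * (K⁻¹ : (Module.End 𝕜 V)ˣ) = q ^ 2 • e)
    (hKf : (K : Module.End 𝕜 V) * f * (K⁻¹ : (Module.End 𝕜 V)ˣ) = (q ^ 2)⁻¹ • f)
    (hef : e * f - f * e =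
      (q - q⁻¹)⁻¹ • ((K : Module.End 𝕜 V) - (K⁻¹ : (Module.End 𝕜 V)ˣ))) :
    ∃ _ : Module (Uq 𝕜 q) V, IsScalarTower 𝕜 (Uq 𝕜 q) V ∧ ∀ v : V,
      Uq.gen 𝕜 q .e • v = e v ∧ Uq.gen 𝕜 q .f • v = f v ∧
      Uq.gen 𝕜 q .k • v = (K : Module.End 𝕜 V) v ∧
      Uq.gen 𝕜 q .kinv • v = ((K⁻¹ : (Module.End 𝕜 V)ˣ) : Module.End 𝕜 V) v := by
  let g : UqGen → Module.End 𝕜 V := fun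
    | .e => e
    | .f => f
    | .k => K
    | .kinv => (K⁻¹ : (Module.End 𝕜 V)ˣ)
  let φ : Uq 𝕜 q →ₐ[𝕜] Module.End 𝕜 V := RingQuot.liftAlgHom 𝕜
    ⟨FreeAlgebra.lift 𝕜 g, by
      intro x y hxy
      cases hxy <;> simp [g, hKe, hKf, hef]⟩
  have hφ : ∀ x, φ (Uq.gen 𝕜 q x) = g x := fun x => by
    simp [φ, Uq.gen, RingQuot.liftAlgHom_mkAlgHom_apply]
  let _ : Module (Uq 𝕜 q) V := Module.compHom V φ.toRingHom
  refine ⟨inferInstance, ⟨fun c x v => ?_⟩, fun v => ?_⟩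
  · change φ (c • x) v = c • φ x v
    rw [map_smul, LinearMap.smul_apply]
  · exact ⟨congrArg (· v) (hφ .e), congrArg (· v) (hφ .f), congrArg (· v) (hφ .k),
      congrArg (· v) (hφ .kinv)⟩

/-- The scalar by which a lowering operator sends `R ^ n v` to `R ^ (n - 1) v`, for `v` primitive
of degree `i`. -/
def loweringCoeff {𝕜 : Type*} [Field 𝕜] (q : 𝕜) (d i n : ℕ) : 𝕜 :=
  (q ^ (n : ℤ) - q ^ (-n : ℤ)) *
    (q ^ ((d : ℤ) - 2 * i - n + 1) - q ^ (-((d : ℤ) - 2 * i - n + 1)))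

theorem loweringCoeff_zero {𝕜 : Type*} [Field 𝕜] (q : 𝕜) (d i : ℕ) :
    loweringCoeff q d i 0 = 0 := by
  simp [loweringCoeff]

theorem loweringCoeff_last {𝕜 : Type*} [Field 𝕜] (q : 𝕜) {d i n : ℕ} (h : 2 * i + n = d + 1) :
    loweringCoeff q d i n = 0 := by
  have : (d : ℤ) - 2 * i - n + 1 = 0 := by omega
  simp [loweringCoeff, this]

/-- With `m = d - 2i` this is the quantum integer identity `[n+1][m-n] - [n][m-n+1] = [m-2n]`,
cleared of denominators. -/
theorem loweringCoeff_succ_sub {𝕜 : Type*} [Field 𝕜] {q : 𝕜} (hq : q ≠ 0) (d i n : ℕ) :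
    loweringCoeff q d i (n + 1) - loweringCoeff q d i n =
      (q - q⁻¹) * (q ^ ((d : ℤ) - 2 * (i + n : ℕ)) - q ^ (2 * (i + n : ℕ) - (d : ℤ))) := by
  have e1 : (d : ℤ) - 2 * i - (n + 1 : ℕ) + 1 = ((d : ℤ) - 2 * i) - n := by push_cast; ring
  have e2 : (d : ℤ) - 2 * (i + n : ℕ) = ((d : ℤ) - 2 * i) - n - n := by push_cast; ring
  have e3 : 2 * (i + n : ℕ) - (d : ℤ) = -(((d : ℤ) - 2 * i) - n - n) := by push_cast; ring
  rw [loweringCoeff, loweringCoeff, e1, e2, e3]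
  generalize (d : ℤ) - 2 * i = m
  rw [Nat.cast_succ]
  generalize (n : ℤ) = n
  simp only [zpow_neg, zpow_add₀ hq, zpow_sub₀ hq, zpow_one]
  have hm := zpow_ne_zero m hq
  have hn := zpow_ne_zero n hq
  generalize q ^ m = y at *
  generalize q ^ n = x at *
  field_simp
  ring

namespace IsLefschetz

variable {𝕜 V : Type*} [Field 𝕜] [AddCommGroup V] [Module 𝕜 V] {d : ℕ}
  {U : ℕ → Submodule 𝕜 V} {R ψ K K' : Module.End 𝕜 V} (h : IsLefschetz U R d) {q : 𝕜}
include h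

theorem weight_mul_raise (hq : q ≠ 0)
    (hK : ∀ n, ∀ v ∈ U n, K v = q ^ ((d : ℤ) - 2 * (n : ℤ)) • v) :
    K * R = (q ^ 2)⁻¹ • (R * K) := by
  refine h.ext_grading fun n _ v hv => ?_
  simp only [LinearMap.smul_apply, Module.End.mul_apply]
  rw [hK _ _ (h.raise n v hv), hK n v hv, map_smul, smul_smul]
  congr 1
  rw [show (d : ℤ) - 2 * ((n + 1 : ℕ) : ℤ) = -((2 : ℕ) : ℤ) + (d - 2 * n) by push_cast; ring,
    zpow_add₀ hq, zpow_neg, zpow_natCast]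

theorem weight_mul_lower (hq : q ≠ 0)
    (hK : ∀ n, ∀ v ∈ U n, K v = q ^ ((d : ℤ) - 2 * (n : ℤ)) • v)
    (hψ : ∀ i n, 2 * i + n ≤ d → ∀ v ∈ primitivePart U R d i,
      ψ ((R ^ n) v) = loweringCoeff q d i n • (R ^ (n - 1)) v) :
    K * ψ = q ^ 2 • (ψ * K) := by
  refine h.ext_primitive fun i n hin v hv => ?_
  simp only [LinearMap.smul_apply, Module.End.mul_apply]
  rw [hK _ _ (h.pow_mem n hv.1), map_smul, hψ i n hin v hv]
  rcases n with _ | n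
  · simp [loweringCoeff_zero]
  · rw [Nat.add_sub_cancel, map_smul, hK _ _ (h.pow_mem n hv.1), smul_smul, smul_smul, smul_smul,
      mul_comm]
    congr 2
    rw [show (d : ℤ) - 2 * ((i + n : ℕ) : ℤ) = ((2 : ℕ) : ℤ) + (d - 2 * ((i + (n + 1) : ℕ) : ℤ)) by
      push_cast; ring, zpow_add₀ hq, zpow_natCast]

theorem lower_mul_raise_sub (hq : q ≠ 0)
    (hK : ∀ n, ∀ v ∈ U n, K v = q ^ ((d : ℤ) - 2 * (n : ℤ)) • v)
    (hK' : ∀ n, ∀ v ∈ U n, K' v = q ^ (2 * (n : ℤ) - (d : ℤ)) • v)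
    (hψ : ∀ i n, 2 * i + n ≤ d → ∀ v ∈ primitivePart U R d i,
      ψ ((R ^ n) v) = loweringCoeff q d i n • (R ^ (n - 1)) v) :
    ψ * R - R * ψ = (q - q⁻¹) • (K - K') := by
  refine h.ext_primitive fun i n hin v hv => ?_
  have h1 : ψ (R ((R ^ n) v)) = loweringCoeff q d i (n + 1) • (R ^ n) v := by
    rw [← Module.End.mul_apply R, ← pow_succ']
    rcases Nat.lt_or_ge (2 * i + n) d with hlt | hge
    · exact hψ i (n + 1) hlt v hv
    -- At the end of the string, `2i + n = d`, both the vector `R ^ (n + 1) v` and the coefficient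
    -- vanish.
    · rw [pow_apply_eq_zero hv (by omega), loweringCoeff_last q (by omega), map_zero, zero_smul]
  have h2 : R (ψ ((R ^ n) v)) = loweringCoeff q d i n • (R ^ n) v := by
    rw [hψ i n hin v hv, map_smul, ← Module.End.mul_apply, ← pow_succ']
    -- For `n = 0` the truncated exponent `n - 1` is `0`, but the coefficient is zero.
    rcases n with _ | n
    · simp [loweringCoeff_zero]
    · rfl
  simp only [LinearMap.smul_apply, LinearMap.sub_apply, Module.End.mul_apply]
  rw [h1, h2, hK _ _ (h.pow_mem n hv.1), hK' _ _ (h.pow_mem n hv.1), ← sub_smul, ← sub_smul,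
    smul_smul, loweringCoeff_succ_sub hq]

end IsLefschetz

/-! ### `K` and `ψ` in terms of the grading, and the conclusion. -/

namespace TDSystem

variable {𝕜 V : Type*} [Field 𝕜] [AddCommGroup V] [Module 𝕜 V] {d : ℕ} {Φ : TDSystem 𝕜 V d}
  {q : 𝕜}

theorem isK_iff (X : Module.End 𝕜 V) :
    Φ.IsK q X ↔ ∀ n, ∀ v ∈ Φ.split n, X v = q ^ ((d : ℤ) - 2 * (n : ℤ)) • v := by
  constructor
  · intro hX n v hv
    rcases Nat.lt_or_ge d n with hn | hn
    · rw [Φ.isGradedBy.eq_bot n hn, Submodule.mem_bot] at hv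
      simp [hv]
    · exact hX ⟨n, by omega⟩ v (by rwa [U_eq_split])
  · intro hX i v hv
    rw [U_eq_split] at hv
    exact hX i v hv

theorem isPsi_iff {R : Module.End 𝕜 V}
    (hR : ∀ n : Fin (d + 1), ∀ v ∈ Φ.split n, R v = Φ.A v - Φ.θ n • v) (X : Module.End 𝕜 V) :
    Φ.IsPsi q X ↔ ∀ i n, 2 * i + n ≤ d → ∀ v ∈ primitivePart Φ.split R d i,
      X ((R ^ n) v) = loweringCoeff q d i n • (R ^ (n - 1)) v := by
  have coeff : ∀ i n : ℕ, (q ^ (((i + n : ℕ) : ℤ) - i) - q ^ ((i : ℤ) - (i + n : ℕ))) *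
      (q ^ ((d : ℤ) - i - (i + n : ℕ) + 1) - q ^ ((i : ℤ) + (i + n : ℕ) - d - 1)) =
      loweringCoeff q d i n := fun i n => by
    rw [loweringCoeff]
    congr 3 <;> push_cast <;> ring
  constructor
  · intro hX i n hin v hv
    obtain ⟨h0, h1⟩ := hX i (by omega) v (by rwa [lowest_eq_primitivePart hR (by omega)])
    rcases n with _ | n
    · simp [h0, loweringCoeff_zero]
    · have := h1 (i + (n + 1)) (by omega) (by omega)
      rwa [coeff, aeval_τ_apply hR hv.1 _ (by omega),
        show i + (n + 1) - 1 = i + n by omega, aeval_τ_apply hR hv.1 _ (by omega)] at this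
  · intro hX i hi v hv
    rw [lowest_eq_primitivePart hR hi] at hv
    refine ⟨by simpa [loweringCoeff_zero] using hX i 0 (by omega) v hv, fun j hij hj => ?_⟩
    obtain ⟨n, rfl⟩ := Nat.exists_eq_add_of_lt hij
    rw [add_assoc, coeff, aeval_τ_apply hR hv.1 _ (by omega),
      show i + (n + 1) - 1 = i + n by omega, aeval_τ_apply hR hv.1 _ (by omega)]
    exact hX i (n + 1) (by omega) v hv

end TDSystem

theorem lemma7p1 {𝕜 V : Type*} [Field 𝕜] [IsAlgClosed 𝕜] [AddCommGroup V] [Module 𝕜 V]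
    [FiniteDimensional 𝕜 V] [Nontrivial V] {d : ℕ} (hd : 1 ≤ d)
    (Φ : TDSystem 𝕜 V d) (q a b : 𝕜) (hΦ : Φ.IsQRacah q a b) :
    ∃ (K : (Module.End 𝕜 V)ˣ) (ψ : Module.End 𝕜 V),
      (∀ X : Module.End 𝕜 V, Φ.IsK q X ↔ X = (K : Module.End 𝕜 V)) ∧
      (∀ X : Module.End 𝕜 V, Φ.IsPsi q X ↔ X = ψ) ∧
      ∃ _ : Module (Uq 𝕜 q) V,
        IsScalarTower 𝕜 (Uq 𝕜 q) V ∧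
        ∀ v : V,
          Uq.gen 𝕜 q .e • v = (q - q⁻¹)⁻¹ • ψ v ∧
          Uq.gen 𝕜 q .f • v = (q - q⁻¹)⁻¹ • Φ.raising a K v ∧
          Uq.gen 𝕜 q .k • v = (K : Module.End 𝕜 V) v ∧
          Uq.gen 𝕜 q .kinv • v = ((K⁻¹ : (Module.End 𝕜 V)ˣ) : Module.End 𝕜 V) v := by
  have hq := hΦ.q_ne_zero
  have hq1 : q - q⁻¹ ≠ 0 := fun h0 => hΦ.q_pow_four_ne_one <| by
    have h1 : q * q = 1 := by
      nth_rewrite 2 [sub_eq_zero.1 h0]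
      exact mul_inv_cancel₀ hq
    rw [show q ^ 4 = (q * q) * (q * q) by ring, h1, one_mul]
  obtain ⟨K₀, hK⟩ := Φ.isGradedBy.exists_scalar_map fun n => q ^ ((d : ℤ) - 2 * (n : ℤ))
  obtain ⟨K₁, hK'⟩ := Φ.isGradedBy.exists_scalar_map fun n => q ^ (2 * (n : ℤ) - (d : ℤ))
  have hinv : ∀ n : ℕ, q ^ ((d : ℤ) - 2 * (n : ℤ)) * q ^ (2 * (n : ℤ) - (d : ℤ)) = 1 :=
    fun n => by rw [← zpow_add₀ hq]; simp
  let K : (Module.End 𝕜 V)ˣ :=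
    { val := K₀
      inv := K₁
      val_inv := Φ.isGradedBy.ext_grading fun n _ v hv => by
        rw [Module.End.mul_apply, hK' n v hv, map_smul, hK n v hv, smul_smul, mul_comm, hinv,
          one_smul, Module.End.one_apply]
      inv_val := Φ.isGradedBy.ext_grading fun n _ v hv => by
        rw [Module.End.mul_apply, hK n v hv, map_smul, hK' n v hv, smul_smul, hinv,
          one_smul, Module.End.one_apply] }
  -- This is where the `q`-Racah form of `θ n` enters.
  have hR : ∀ n : Fin (d + 1), ∀ v ∈ Φ.split n, Φ.raising a K v = Φ.A v - Φ.θ n • v := by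
    intro n v hv
    change Φ.A v - a • K₀ v - a⁻¹ • K₁ v = _
    rw [hK n v hv, hK' n v hv, hΦ.θ_eq, smul_smul, smul_smul, add_smul, sub_sub]
  have hL := TDSystem.isLefschetz hR
  obtain ⟨ψ, hψ⟩ := hL.exists_lowering (loweringCoeff q d)
  refine ⟨K, ψ, fun X => ?_, fun X => ?_, ?_⟩
  · rw [TDSystem.isK_iff]
    exact ⟨fun hX => Φ.isGradedBy.ext_grading fun n _ v hv => (hX n v hv).trans (hK n v hv).symm,
      fun hX => hX ▸ hK⟩
  · rw [TDSystem.isPsi_iff hR]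
    exact ⟨fun hX => hL.ext_primitive fun i n hin v hv =>
      (hX i n hin v hv).trans (hψ i n hin v hv).symm, fun hX => hX ▸ hψ⟩
  · refine exists_module_Uq q K ((q - q⁻¹)⁻¹ • ψ) ((q - q⁻¹)⁻¹ • Φ.raising a K) ?_ ?_ ?_
    · have : (K : Module.End 𝕜 V) * ψ = q ^ 2 • (ψ * K) := hL.weight_mul_lower hq hK hψ
      rw [mul_smul_comm, this, smul_mul_assoc, smul_mul_assoc, Units.mul_inv_cancel_right,
        smul_comm]
    · have : (K : Module.End 𝕜 V) * Φ.raising a K = (q ^ 2)⁻¹ • (Φ.raising a K * K) :=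
        hL.weight_mul_raise hq hK
      rw [mul_smul_comm, this, smul_mul_assoc, smul_mul_assoc, Units.mul_inv_cancel_right,
        smul_comm]
    · have : ψ * Φ.raising a K - Φ.raising a K * ψ =
          (q - q⁻¹) • ((K : Module.End 𝕜 V) - (K⁻¹ : (Module.End 𝕜 V)ˣ)) :=
        hL.lower_mul_raise_sub hq hK hK' hψ
      rw [smul_mul_smul_comm, smul_mul_smul_comm, ← smul_sub, this, smul_smul, mul_assoc,
        inv_mul_cancel₀ hq1, mul_one]
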